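/- **Setting.** Let $(\mathcal S,\mathcal A,\mathcal P,r,\gamma,d_0)$ be a finite Markov decision process with $\gamma\in[0,1]$, and let $\pi_\theta$, $\theta\in\mathbb R^n$, be a differentiable parametrised family of stochastic policies with score $g(s,a)=\nabla_\theta\log\pi_\theta(a\mid s)\in\mathbb R^n$. Let $d_\gamma^{\pi_\theta}$ be the state–action distribution $$d_\gamma^{\pi_\theta}(s,a)=(1-\gamma)\sum_{t\ge0}\gamma^t\,\mathbb P(s_t=s,a_t=a)\ \ (\gamma<1),\qquad d_1^{\pi_\theta}(s,a)=\lim_{T\to\infty}\frac1T\sum_{t=0}^{T}\mathbb P(s_t=s,a_t=a),$$ where $s_0\sim d_0$, $a_t\sim\pi_\theta(\cdot\mid s_t)$, $s_{t+1}\sim\mathcal P(\cdot\mid s_t,a_t)$. Let $\Phi:\mathcal S\times\mathcal A\to\mathbb R^d$ be a feature map and $\lambda\ge0$. For $\alpha,\beta\in\mathbb R^{d\times n}$ and $\tau\in\mathbb R^n$ put $w=\alpha^T\Phi$, $f=\beta^T\Phi$ and $$L(\alpha,\beta,\tau)=\mathbb E[f(s,a)\cdot w(s,a)]-\mathbb E[f(s,a)\cdot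 g(s,a)]-\gamma\,\mathbb E[f(s',a')\cdot w(s,a)]-\tfrac12\mathbb E\|f(s,a)\|^2+\lambda\big(\tau\cdot\mathbb E[w(s,a)]-\tfrac12\|\tau\|^2\big),$$ with $(s,a)\sim d_\gamma^{\pi_\theta}$, $s'\sim\mathcal P(\cdot\mid s,a)$, $a'\sim\pi_\theta(\cdot\mid s')$. **Algorithm.** Let $X,Y\subset\mathbb R^{d\times n}$ and $Z\subset\mathbb R^{n}$ be closed, bounded and convex, with Euclidean (Frobenius) projections $\Pi_X,\Pi_Y,\Pi_Z$, and let $(\alpha_1,\beta_1,\tau_1)\in X\times Y\times Z$. Draw i.i.d. samples $(s_t,a_t,s_t',a_t')$ with the law above; write $\Phi_t=\Phi(s_t,a_t)$, $\Phi_t'=\Phi(s_t',a_t')$, $g_t=g(s_t,a_t)$, $\delta_t=\Phi_t\Phi_t^T-\gamma\Phi_t\Phi_t'^T$, and iterate $$\alpha_{t+1}=\Pi_X\big(\alpha_t-\varepsilon_t(\delta_t\beta_t+\lambda\Phi_t\tau_t^T)\big),\quad \beta_{t+1}=\Pi_Y\big(\beta_t+\varepsilon_t(\delta_t^T\alpha_t-\Phi_tg_t^T-\Phi_t\Phi_t^T\beta_t)\big),\quad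 \tau_{t+1}=\Pi_Z\big(\tau_t+\varepsilon_t\lambda(\alpha_t^T\Phi_t-\tau_t)\big).$$ After $m$ steps return the weighted averages $\bar\alpha=\sum_{t=1}^m\varepsilon_t\alpha_t\big/\sum_{t=1}^m\varepsilon_t$, and likewise $\bar\beta,\bar\tau$. **Theorem.** Let $X,Y,Z,\lambda$ be as above, let $K_\Phi,K_g,c_2\in\mathbb R$ and $c_1>0$. There is a constant $C_0>0$, depending only on $X,Y,Z,\lambda,K_\Phi,K_g,c_1,c_2$, such that the following holds for every such Markov decision process, policy, parameter $\theta$ and feature map with $\|\Phi(s,a)\|^2\le K_\Phi$ and $\|g(s,a)\|^2\le K_g$ for all $(s,a)$, every starting point in $X\times Y\times Z$, every $m\ge1$, all deterministic step sizes of order $1/\sqrt m$, that is, $c_1/\sqrt m\le\varepsilon_t\le c_2/\sqrt m$ for $1\le t\le m$ (in particular $\varepsilon_t=c/\sqrt m$ for a constant $c>0$), and every $\delta\in(0,1)$: with probability at least $1-\delta$, $$\epsilon_g(\bar\alpha,\bar\beta,\bar\tau):=\max_{(\beta,\tau)\in Y\times Z}L(\bar\alpha,\beta,\tau)-\min_{\alpha\in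 X}L(\alpha,\bar\beta,\bar\tau)\;\le\;C_0\sqrt{\frac5m}\Big(8+2\log\frac2\delta\Big).$$ In particular, for fixed $\delta$ the optimality gap after $m$ steps is $O(m^{-1/2})$. -/

import Mathlib

open Filter Topology MeasureTheory ProbabilityTheory

noncomputable section

namespace LogDensityGradient

/-- A finite Markov decision process `(S, A, P, r, γ, d₀)`, with `γ ∈ [0, 1]`. -/
structure MDP (S A : Type*) [Fintype S] where
  P : S → A → S → ℝ
  P_nonneg : ∀ s a s', 0 ≤ P s a s'
  P_sum : ∀ s a, ∑ s', P s a s' = 1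
  r : S → A → ℝ
  γ : ℝ
  γ_nonneg : 0 ≤ γ
  γ_le_one : γ ≤ 1
  d₀ : S → ℝ
  d₀_nonneg : ∀ s, 0 ≤ d₀ s
  d₀_sum : ∑ s, d₀ s = 1

/-- A differentiable family of stochastic policies `π_θ(a | s)`, `θ ∈ ℝⁿ`. -/
structure ParamPolicy (n : ℕ) (S A : Type*) [Fintype A] where
  prob : EuclideanSpace ℝ (Fin n) → S → A → ℝ
  prob_nonneg : ∀ θ s a, 0 ≤ prob θ s a
  prob_sum : ∀ θ s, ∑ a, prob θ s a = 1
  differentiable : ∀ s a, Differentiable ℝ fun θ => prob θ s a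

/-- The parameter space `ℝ^{d × n}` with its Euclidean (Frobenius) norm. -/
abbrev Param (d n : ℕ) : Type := EuclideanSpace ℝ (Fin d × Fin n)

/-- The entries of `x ∈ ℝ^{d × n}` as a matrix. -/
def toMat {d n : ℕ} (x : Param d n) : Matrix (Fin d) (Fin n) ℝ :=
  Matrix.of fun i j => x (i, j)

/-- A matrix as an element of `ℝ^{d × n}` with the Euclidean norm. -/
def ofMat {d n : ℕ} (M : Matrix (Fin d) (Fin n) ℝ) : Param d n :=
  WithLp.toLp 2 fun p => M p.1 p.2

section Occupancy

variable {n : ℕ} {S A : Type*} [Fintype S] [Fintype A]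

/-- The score `∇_θ log π_θ(a | s)`. -/
def score (π : ParamPolicy n S A) (θ : EuclideanSpace ℝ (Fin n)) (s : S) (a : A) :
    EuclideanSpace ℝ (Fin n) :=
  gradient (fun ϑ => Real.log (π.prob ϑ s a)) θ

/-- `ℙ(s_t = s, a_t = a)` when `s₀ ∼ d₀`, `a_t ∼ π_θ(· | s_t)`, `s_{t+1} ∼ P(· | s_t, a_t)`. -/
def stepProb (M : MDP S A) (π : ParamPolicy n S A) (θ : EuclideanSpace ℝ (Fin n)) :
    ℕ → S → A → ℝ
  | 0, s, a => M.d₀ s * π.prob θ s a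
  | t + 1, s', a' => ∑ s, ∑ a, stepProb M π θ t s a * M.P s a s' * π.prob θ s' a'

/-- The average (discounted) state-action stationary distribution `d_γ^{π_θ}`:
`(1 - γ) ∑ₜ γᵗ ℙ(s_t = s, a_t = a)` if `γ < 1`, and the Cesàro limit of
`ℙ(s_t = s, a_t = a)` if `γ = 1`. -/
def occupancy (M : MDP S A) (π : ParamPolicy n S A) (θ : EuclideanSpace ℝ (Fin n))
    (s : S) (a : A) : ℝ :=
  if M.γ < 1 then (1 - M.γ) * ∑' t : ℕ, M.γ ^ t * stepProb M π θ t s a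
  else limUnder atTop fun T : ℕ =>
    (1 / (T : ℝ)) * ∑ t ∈ Finset.range (T + 1), stepProb M π θ t s a

/-- The expectation `𝔼_{(s,a) ∼ d_γ^{π_θ}} [h(s, a)]`. -/
def expect (M : MDP S A) (π : ParamPolicy n S A) (θ : EuclideanSpace ℝ (Fin n))
    (h : S → A → ℝ) : ℝ :=
  ∑ s, ∑ a, occupancy M π θ s a * h s a

/-- The conditional expectation of `f(s', a')` for `s' ∼ P(· | s, a)`, `a' ∼ π_θ(· | s')`. -/
def nextExpect (M : MDP S A) (π : ParamPolicy n S A) (θ : EuclideanSpace ℝ (Fin n))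
    (f : S → A → EuclideanSpace ℝ (Fin n)) (s : S) (a : A) : EuclideanSpace ℝ (Fin n) :=
  ∑ s', ∑ a', (M.P s a s' * π.prob θ s' a') • f s' a'

/-- The saddle-point objective `L_γ(w, f, τ)`. -/
def objective (M : MDP S A) (π : ParamPolicy n S A) (θ : EuclideanSpace ℝ (Fin n)) (lam : ℝ)
    (w f : S → A → EuclideanSpace ℝ (Fin n)) (τ : EuclideanSpace ℝ (Fin n)) : ℝ :=
  expect M π θ (fun s a => inner ℝ (f s a) (w s a))
    - expect M π θ (fun s a => inner ℝ (f s a) (score π θ s a))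
    - M.γ * expect M π θ (fun s a => inner ℝ (nextExpect M π θ f s a) (w s a))
    - (1 / 2) * expect M π θ (fun s a => ‖f s a‖ ^ 2)
    + lam * (expect M π θ (fun s a => inner ℝ τ (w s a)) - (1 / 2) * ‖τ‖ ^ 2)

/-- The linear approximation `(s, a) ↦ αᵀ Φ(s, a)`. -/
def linApprox {d : ℕ} (Φ : S → A → EuclideanSpace ℝ (Fin d)) (α : Param d n) (s : S) (a : A) :
    EuclideanSpace ℝ (Fin n) :=
  WithLp.toLp 2 (Matrix.mulVec (toMat α).transpose (Φ s a))

/-- `L(α, β, τ) = L_γ(αᵀ Φ, βᵀ Φ, τ)`. -/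
def linObjective {d : ℕ} (M : MDP S A) (π : ParamPolicy n S A) (θ : EuclideanSpace ℝ (Fin n))
    (lam : ℝ) (Φ : S → A → EuclideanSpace ℝ (Fin d)) (α β : Param d n)
    (τ : EuclideanSpace ℝ (Fin n)) : ℝ :=
  objective M π θ lam (linApprox Φ α) (linApprox Φ β) τ

end Occupancy

/-- The Euclidean projection onto `X`: the nearest point of `X` (it exists and is unique
when `X` is nonempty, closed and convex). -/
def proj {E : Type*} [NormedAddCommGroup E] (X : Set E) (x : E) : E :=
  Classical.epsilon fun p => p ∈ X ∧ ∀ q ∈ X, ‖x - p‖ ≤ ‖x - q‖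

/-- The variables `(α, β, τ)`. -/
structure Vars (d n : ℕ) where
  α : Param d n
  β : Param d n
  τ : EuclideanSpace ℝ (Fin n)

section Iteration

variable {d n : ℕ} {S A : Type*} [Fintype S] [Fintype A]

/-- The matrix `δ = Φ(s,a) Φ(s,a)ᵀ - γ Φ(s,a) Φ(s',a')ᵀ` of a sample `(s, a, s', a')`. -/
def deltaMat (γ : ℝ) (Φ : S → A → EuclideanSpace ℝ (Fin d)) (x : S × A × S × A) :
    Matrix (Fin d) (Fin d) ℝ :=
  Matrix.vecMulVec (Φ x.1 x.2.1) (Φ x.1 x.2.1)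
    - γ • Matrix.vecMulVec (Φ x.1 x.2.1) (Φ x.2.2.1 x.2.2.2)

/-- One step of the projected log density gradient iteration, with step size `ε`
and sample `x = (s, a, s', a')`. In column form, with `Φ = Φ(s,a)` and `g` the score at `(s,a)`:
`α ← Π_X (α - ε (δ β + λ Φ τ))`, `β ← Π_Y (β + ε (δᵀ α - Φ gᵀ - Φ Φᵀ β))`,
`τ ← Π_Z (τ + ε λ (αᵀ Φ - τ))`. -/
def pldgStep (M : MDP S A) (π : ParamPolicy n S A) (θ : EuclideanSpace ℝ (Fin n)) (lam : ℝ)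
    (Φ : S → A → EuclideanSpace ℝ (Fin d)) (X Y : Set (Param d n))
    (Z : Set (EuclideanSpace ℝ (Fin n))) (ε : ℝ) (x : S × A × S × A) (v : Vars d n) :
    Vars d n where
  α := proj X (v.α - ε • ofMat
    (deltaMat M.γ Φ x * toMat v.β + lam • Matrix.vecMulVec (Φ x.1 x.2.1) v.τ))
  β := proj Y (v.β + ε • ofMat
    ((deltaMat M.γ Φ x).transpose * toMat v.α
      - Matrix.vecMulVec (Φ x.1 x.2.1) (score π θ x.1 x.2.1)
      - Matrix.vecMulVec (Φ x.1 x.2.1) (Φ x.1 x.2.1) * toMat v.β))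
  τ := proj Z (v.τ + ε • lam • (linApprox Φ v.α x.1 x.2.1 - v.τ))

/-- The iterates. Indices are shifted by one: `pldgIter … 0` is the starting point
`(α₁, β₁, τ₁)`, and the step from index `t` to index `t + 1` uses `ε t` and `ξ t`. -/
def pldgIter (M : MDP S A) (π : ParamPolicy n S A) (θ : EuclideanSpace ℝ (Fin n)) (lam : ℝ)
    (Φ : S → A → EuclideanSpace ℝ (Fin d)) (X Y : Set (Param d n))
    (Z : Set (EuclideanSpace ℝ (Fin n))) (ε : ℕ → ℝ) (v₁ : Vars d n) (ξ : ℕ → S × A × S × A) :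
    ℕ → Vars d n
  | 0 => v₁
  | t + 1 => pldgStep M π θ lam Φ X Y Z (ε t) (ξ t)
      (pldgIter M π θ lam Φ X Y Z ε v₁ ξ t)

/-- The average of the first `m` vectors of a sequence `u` with weights `ε`. -/
def weightedAvg {E : Type*} [AddCommGroup E] [Module ℝ E] (ε : ℕ → ℝ) (m : ℕ) (u : ℕ → E) : E :=
  (∑ t ∈ Finset.range m, ε t)⁻¹ • ∑ t ∈ Finset.range m, ε t • u t

/-- The output `(ᾱ, β̄, τ̄)` of the iteration after `m` steps. -/
def pldgOutput (M : MDP S A) (π : ParamPolicy n S A) (θ : EuclideanSpace ℝ (Fin n)) (lam : ℝ)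
    (Φ : S → A → EuclideanSpace ℝ (Fin d)) (X Y : Set (Param d n))
    (Z : Set (EuclideanSpace ℝ (Fin n))) (ε : ℕ → ℝ) (v₁ : Vars d n) (ξ : ℕ → S × A × S × A)
    (m : ℕ) : Vars d n where
  α := weightedAvg ε m fun t => (pldgIter M π θ lam Φ X Y Z ε v₁ ξ t).α
  β := weightedAvg ε m fun t => (pldgIter M π θ lam Φ X Y Z ε v₁ ξ t).β
  τ := weightedAvg ε m fun t => (pldgIter M π θ lam Φ X Y Z ε v₁ ξ t).τ

/-- The optimality gap
`max_{(β, τ) ∈ Y × Z} L(v.α, β, τ) - min_{α ∈ X} L(α, v.β, v.τ)`; for nonempty compact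
`X`, `Y`, `Z` the supremum and the infimum are attained. -/
def optGap (M : MDP S A) (π : ParamPolicy n S A) (θ : EuclideanSpace ℝ (Fin n)) (lam : ℝ)
    (Φ : S → A → EuclideanSpace ℝ (Fin d)) (X Y : Set (Param d n))
    (Z : Set (EuclideanSpace ℝ (Fin n))) (v : Vars d n) : ℝ :=
  sSup ((fun p : Param d n × EuclideanSpace ℝ (Fin n) =>
      linObjective M π θ lam Φ v.α p.1 p.2) '' (Y ×ˢ Z))
    - sInf ((fun α : Param d n => linObjective M π θ lam Φ α v.β v.τ) '' X)

/-- `ξ₀, ξ₁, …` are i.i.d. samples `(s, a, s', a')` with `(s, a) ∼ d_γ^{π_θ}`,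
`s' ∼ P(· | s, a)` and `a' ∼ π_θ(· | s')`. -/
structure IsSampleStream [MeasurableSpace S] [MeasurableSpace A] (M : MDP S A)
    (π : ParamPolicy n S A) (θ : EuclideanSpace ℝ (Fin n)) {Ω : Type*} [MeasurableSpace Ω]
    (μ : Measure Ω) (ξ : ℕ → Ω → S × A × S × A) : Prop where
  measurable : ∀ t, Measurable (ξ t)
  indep : iIndepFun ξ μ
  law : ∀ t s a s' a', μ.real (ξ t ⁻¹' {(s, a, s', a')}) =
    occupancy M π θ s a * M.P s a s' * π.prob θ s' a'

end Iteration

end LogDensityGradient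

end

/-!
The algorithm is projected stochastic gradient descent-ascent for a function `L` that is affine in
`α` and concave in `(β, τ)`. On the Euclidean space of triples `z = (α, β, τ)` it reads
`z ← P (z - ε G(ξ, z))`, where `P` projects onto `X × Y × Z` and `G(ξ, z)` is an unbiased, bounded
estimate of the saddle operator `Ḡ = (∇_α L, -∇_β L, -∇_τ L)` (`toJoint_pldgStep`).

For every `u` in `X × Y × Z`, convexity-concavity and Jensen's inequality bound
`(∑ ε_t) (L(ᾱ, u_β, u_τ) - L(u_α, β̄, τ̄))` by `∑ ε_t ⟨Ḡ(z_t), z_t - u⟩`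
(`mul_linObjective_weightedAvg_sub_le`). Both inequalities already hold for the saddle function
of each single sample (`sampleLoss_sub_le_inner`, `mul_sampleLoss_weightedAvg_sub_le`), whose
expectation is `L`, so the gradient of `L` itself is never needed.

Replacing `Ḡ` by `G = Ḡ + Δ`, the sum `∑ ε_t ⟨G, z_t - u⟩` telescopes because `P` is nonexpansive
towards points of `X × Y × Z` (`sum_inner_le_of_projected`). The noise `∑ ε_t ⟨Δ_t, u - z_t⟩`
involves a comparator that depends on all samples. A shadow sequence `v_t`, a projected iteration
driven by `-Δ_t`, has small regret against every `u` simultaneously, which leaves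
`∑ ε_t ⟨Δ_t, v_t - z_t⟩`; here `v_t` and `z_t` depend only on earlier samples. This is a
martingale with increments of order `1 / √m`, so its exponential moment is bounded independently
of `m` (`integral_exp_sum_le`), and Markov's inequality yields a tail bound of the form
`C + log (1 / δ)` (`one_sub_le_measureReal_forall_sum_inner_le`). Dividing by
`∑ ε_t ≥ c₁ √m` gives the rate.

The samples' law has total mass one, hence no property of the occupancy measure, such as the
existence of the Cesàro limit when `γ = 1`, has to be established separately.
-/

namespace LogDensityGradient

/-! ### Exponential moments of sums with independent innovations -/

section Concentration

theorem integral_exp_le_of_integral_eq_zero {E : Type*} [MeasurableSpace E]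
    [DiscreteMeasurableSpace E] {ν : Measure E} [IsProbabilityMeasure ν] {h : E → ℝ} {b : ℝ}
    (hb : ∀ y, |h y| ≤ b) (h0 : ∫ y, h y ∂ν = 0) :
    ∫ y, Real.exp (h y) ∂ν ≤ Real.exp (b ^ 2 / 2) := by
  have hsub := (hasSubgaussianMGF_of_mem_Icc_of_integral_eq_zero (μ := ν) (X := h)
    (a := -b) (b := b) (Measurable.of_discrete).aemeasurable
    (ae_of_all _ fun y => abs_le.1 (hb y)) h0).mgf_le 1
  refine (le_of_eq ?_).trans (hsub.trans (le_of_eq ?_))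
  · simp [mgf]
  · congr 1
    simp only [NNReal.coe_pow, NNReal.coe_div, coe_nnnorm, Real.norm_eq_abs, NNReal.coe_ofNat,
      div_pow, sq_abs]
    ring

/-- A recursively defined process is determined at time `t` by the first `t` inputs. -/
theorem dependsOn_of_recursion {E σ : Type*} {u : (ℕ → E) → ℕ → σ} {u₀ : σ}
    {f : ℕ → (ℕ → E) → σ → σ} (hu₀ : ∀ x, u x 0 = u₀)
    (hu : ∀ x t, u x (t + 1) = f t x (u x t))
    (hf : ∀ t, DependsOn (f t) (Set.Iio (t + 1))) (t : ℕ) :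
    DependsOn (fun x => u x t) (Set.Iio t) := by
  induction t with
  | zero => intro x y _; simp [hu₀]
  | succ t ih =>
    intro x y hxy
    have h1 : u x t = u y t := ih fun i hi => hxy i (hi.trans (Nat.lt_succ_self t))
    simp only [hu, h1, hf t hxy]

variable {E Ω : Type*} [Finite E] [MeasurableSpace E] [DiscreteMeasurableSpace E]
  [MeasurableSpace Ω] {μ : Measure Ω} [IsProbabilityMeasure μ] {ν : Measure E} {ξ : ℕ → Ω → E}

/-- Azuma's exponential moment bound for a sum whose `t`-th term is a function of the first `t`
samples and of the independent fresh sample `ξ t`, centred with respect to the latter. -/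
theorem integral_exp_sum_le (hm : ∀ t, Measurable (ξ t)) (hind : iIndepFun ξ μ)
    (hlaw : ∀ t, μ.map (ξ t) = ν) {D : ℕ → (ℕ → E) → E → ℝ} {b : ℕ → ℝ}
    (hdep : ∀ t, DependsOn (D t) (Set.Iio t)) (hb : ∀ t x y, |D t x y| ≤ b t)
    (h0 : ∀ t x, ∫ y, D t x y ∂ν = 0) (m : ℕ) :
    ∫ ω, Real.exp (∑ t ∈ Finset.range m, D t (fun i => ξ i ω) (ξ t ω)) ∂μ
      ≤ Real.exp (∑ t ∈ Finset.range m, b t ^ 2 / 2) := by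
  have hν : IsProbabilityMeasure ν := hlaw 0 ▸ Measure.isProbabilityMeasure_map (hm 0).aemeasurable
  obtain ⟨y₀⟩ : Nonempty E := ν.nonempty_of_neZero
  induction m with
  | zero => simp
  | succ k ih =>
    classical
    let W : Ω → (Finset.range k → E) := fun ω i => ξ i ω
    -- Only the first `k` samples matter for the first `k` terms, so the infinite history may be
    -- replaced by the finite one `W`, padded with an arbitrary value.
    let ext : (Finset.range k → E) → ℕ → E := fun w i =>
      if h : i ∈ Finset.range k then w ⟨i, h⟩ else y₀
    have hWm : Measurable W := measurable_pi_lambda _ fun i => hm i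
    have hWi : IndepFun W (ξ k) μ := by
      have := iIndepFun.indepFun_finset (Finset.range k) {k} (by simp) hind hm
      exact this.comp (φ := id)
        (ψ := fun w : ({k} : Finset ℕ) → E => w ⟨k, Finset.mem_singleton_self k⟩)
        measurable_id (measurable_pi_apply (X := fun _ : ({k} : Finset ℕ) => E) _)
    have hext : ∀ ω i, i < k → ext (W ω) i = ξ i ω := fun ω i hi => by
      simp [ext, W, hi]
    let F : (Finset.range k → E) → ℝ := fun w =>
      Real.exp (∑ t ∈ Finset.range k, D t (ext w) (ext w t))
    have hF : ∀ ω, Real.exp (∑ t ∈ Finset.range k, D t (fun i => ξ i ω) (ξ t ω)) = F (W ω) := by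
      intro ω
      simp only [F]
      congr 1
      refine Finset.sum_congr rfl fun t ht => ?_
      have htk := Finset.mem_range.1 ht
      rw [hext ω t htk, hdep t fun i hi => (hext ω i ((Set.mem_Iio.1 hi).trans htk)).symm]
    let h : (Finset.range k → E) × E → ℝ := fun q => F q.1 * Real.exp (D k (ext q.1) q.2)
    calc ∫ ω, Real.exp (∑ t ∈ Finset.range (k + 1), D t (fun i => ξ i ω) (ξ t ω)) ∂μ
        = ∫ ω, h (W ω, ξ k ω) ∂μ := by
          refine integral_congr_ae (ae_of_all _ fun ω => ?_)
          simp only [h, Finset.sum_range_succ, Real.exp_add, hF]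
          rw [hdep k fun i hi => (hext ω i hi).symm]
      _ = ∫ q, h q ∂((μ.map W).prod ν) := by
          rw [← hlaw k, ← hWi.map_prod_eq_prod_map_map hWm.aemeasurable (hm k).aemeasurable,
            integral_map (hWm.prodMk (hm k)).aemeasurable
              (Measurable.of_discrete).aestronglyMeasurable]
      _ = ∫ w, F w * ∫ y, Real.exp (D k (ext w) y) ∂ν ∂(μ.map W) := by
          have := Measure.isProbabilityMeasure_map (μ := μ) hWm.aemeasurable
          rw [integral_prod _ .of_finite]
          simp only [h, integral_const_mul]
      _ ≤ ∫ w, F w * Real.exp (b k ^ 2 / 2) ∂(μ.map W) := by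
          have := Measure.isProbabilityMeasure_map (μ := μ) hWm.aemeasurable
          refine integral_mono .of_finite .of_finite fun w => ?_
          exact mul_le_mul_of_nonneg_left
            (integral_exp_le_of_integral_eq_zero (hb k _) (h0 k _)) (Real.exp_pos _).le
      _ = (∫ ω, F (W ω) ∂μ) * Real.exp (b k ^ 2 / 2) := by
          rw [integral_mul_const, integral_map hWm.aemeasurable
            (Measurable.of_discrete).aestronglyMeasurable]
      _ ≤ _ := by
          simp only [hF] at ih
          rw [Finset.sum_range_succ, Real.exp_add]
          exact mul_le_mul_of_nonneg_right ih (Real.exp_pos _).le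

/-- Markov's inequality for the exponential moment of `integral_exp_sum_le`. -/
theorem one_sub_le_measureReal_sum_le (hm : ∀ t, Measurable (ξ t)) (hind : iIndepFun ξ μ)
    (hlaw : ∀ t, μ.map (ξ t) = ν) {D : ℕ → (ℕ → E) → E → ℝ} {b : ℕ → ℝ}
    (hdep : ∀ t, DependsOn (D t) (Set.Iio t)) (hb : ∀ t x y, |D t x y| ≤ b t)
    (h0 : ∀ t x, ∫ y, D t x y ∂ν = 0) (m : ℕ) {δ : ℝ} (hδ : 0 < δ) :
    1 - δ ≤ μ.real {ω | ∑ t ∈ Finset.range m, D t (fun i => ξ i ω) (ξ t ω)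
      ≤ ∑ t ∈ Finset.range m, b t ^ 2 / 2 + Real.log (1 / δ)} := by
  obtain ⟨ω₀⟩ : Nonempty Ω := μ.nonempty_of_neZero
  set s : Ω → ℝ := fun ω => ∑ t ∈ Finset.range m, D t (fun i => ξ i ω) (ξ t ω) with hs
  set c : ℝ := ∑ t ∈ Finset.range m, b t ^ 2 / 2 with hc
  have hsm : Measurable s := by
    refine Finset.measurable_sum _ fun t _ => ?_
    let W : Ω → (Finset.range (t + 1) → E) := fun ω i => ξ i ω
    have hWm : Measurable W := measurable_pi_lambda _ fun i => hm i
    let ext : (Finset.range (t + 1) → E) → ℕ → E := fun w i =>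
      if h : i ∈ Finset.range (t + 1) then w ⟨i, h⟩ else ξ 0 ω₀
    have hext : ∀ ω i, i < t + 1 → ext (W ω) i = ξ i ω := fun ω i hi => by
      simp only [ext, W, Finset.mem_range.2 hi, dite_true]
    have : (fun ω => D t (fun i => ξ i ω) (ξ t ω))
        = (fun w => D t (ext w) (ext w t)) ∘ W := by
      funext ω
      simp only [Function.comp]
      rw [hext ω t (Nat.lt_succ_self t), hdep t fun i hi =>
        (hext ω i ((Set.mem_Iio.1 hi).trans (Nat.lt_succ_self t))).symm]
    rw [this]
    exact (Measurable.of_discrete).comp hWm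
  have hbdd : ∀ ω, ‖Real.exp (s ω)‖ ≤ Real.exp (∑ t ∈ Finset.range m, b t) := fun ω => by
    rw [Real.norm_eq_abs, Real.abs_exp]
    exact Real.exp_le_exp.2 (Finset.sum_le_sum fun t _ => (le_abs_self _).trans (hb _ _ _))
  have hint : Integrable (fun ω => Real.exp (s ω)) μ :=
    .of_bound hsm.exp.aestronglyMeasurable _ (ae_of_all _ hbdd)
  have hmarkov := mul_meas_ge_le_integral_of_nonneg
    (ae_of_all μ fun ω => (Real.exp_pos (s ω)).le) hint (Real.exp (c + Real.log (1 / δ)))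
  have hexp := hmarkov.trans (integral_exp_sum_le hm hind hlaw hdep hb h0 m)
  rw [← hc, Real.exp_add, Real.exp_log (by positivity)] at hexp
  have hle : μ.real {ω | Real.exp c * (1 / δ) ≤ Real.exp (s ω)} ≤ δ := by
    have h1 := Real.exp_pos c
    have h2 : Real.exp c * ((1 / δ) * μ.real {ω | Real.exp c * (1 / δ) ≤ Real.exp (s ω)})
        ≤ Real.exp c * 1 := by linarith
    have h3 := le_of_mul_le_mul_left h2 h1
    rwa [one_div_mul_eq_div, div_le_one hδ] at h3
  have hmeas : MeasurableSet {ω | s ω ≤ c + Real.log (1 / δ)} :=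
    measurableSet_le hsm measurable_const
  have hcompl : {ω | s ω ≤ c + Real.log (1 / δ)}ᶜ
      ⊆ {ω | Real.exp c * (1 / δ) ≤ Real.exp (s ω)} := by
    intro ω hω
    rw [Set.mem_compl_iff, Set.mem_ofPred_eq, not_le] at hω
    have := Real.exp_le_exp.2 hω.le
    rwa [Real.exp_add, Real.exp_log (by positivity)] at this
  have h4 := (measureReal_mono (μ := μ) hcompl).trans hle
  rw [probReal_compl_eq_one_sub hmeas] at h4
  linarith

end Concentration

/-! ### Projected stochastic iterations -/

section Projected

variable {H : Type*} [NormedAddCommGroup H] [InnerProductSpace ℝ H]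

/-- The telescoped regret bound of a projected iteration: only the fact that `P` does not
increase distances to points of `K` is used. -/
theorem sum_inner_le_of_projected {K : Set H} {P : H → H}
    (hP : ∀ x, ∀ u ∈ K, ‖P x - u‖ ≤ ‖x - u‖) {ε : ℕ → ℝ} {w g : ℕ → H}
    (hw : ∀ t, w (t + 1) = P (w t - ε t • g t)) {u : H} (hu : u ∈ K) (m : ℕ) :
    ∑ t ∈ Finset.range m, ε t * inner ℝ (g t) (w t - u)
      ≤ ‖w 0 - u‖ ^ 2 / 2 - ‖w m - u‖ ^ 2 / 2
        + (∑ t ∈ Finset.range m, ε t ^ 2 * ‖g t‖ ^ 2) / 2 := by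
  induction m with
  | zero => simp
  | succ k ih =>
    have h1 : ‖w (k + 1) - u‖ ^ 2 ≤ ‖(w k - u) - ε k • g k‖ ^ 2 := by
      rw [hw k, sub_right_comm]
      exact pow_le_pow_left₀ (norm_nonneg _) (hP _ u hu) 2
    rw [norm_sub_sq_real (w k - u), inner_smul_right, norm_smul, mul_pow, Real.norm_eq_abs, sq_abs,
      real_inner_comm] at h1
    rw [Finset.sum_range_succ, Finset.sum_range_succ]
    linarith

variable [CompleteSpace H] {E Ω : Type*} [Finite E] [MeasurableSpace E]
  [DiscreteMeasurableSpace E] [MeasurableSpace Ω] {μ : Measure Ω} [IsProbabilityMeasure μ]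
  {ν : Measure E} {ξ : ℕ → Ω → E}

/-- High-probability bound, uniform in the comparator `u ∈ K`, for the projected stochastic
iteration `z ← P (z - ε G(ξ, z))` driven by i.i.d. samples of law `ν`. In the constant,
`5 / 2 * B ^ 2` collects the second-order terms of the iteration (`‖G‖ ≤ B`) and of the shadow sequence
(`‖Δ‖ ≤ 2 B`); `2 * B ^ 2 * R ^ 2` comes from the exponential moment. -/
theorem one_sub_le_measureReal_forall_sum_inner_le (hm : ∀ t, Measurable (ξ t))
    (hind : iIndepFun ξ μ) (hlaw : ∀ t, μ.map (ξ t) = ν)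
    {K : Set H} {P : H → H} (hPK : ∀ x, P x ∈ K) (hP : ∀ x, ∀ u ∈ K, ‖P x - u‖ ≤ ‖x - u‖)
    {R : ℝ} (hR : ∀ x ∈ K, ∀ u ∈ K, ‖x - u‖ ≤ R)
    {G : E → H → H} {B : ℝ} (hG : ∀ y, ∀ z ∈ K, ‖G y z‖ ≤ B)
    {ε : ℕ → ℝ} {z₁ : H} (hz₁ : z₁ ∈ K) {z : (ℕ → E) → ℕ → H} (hz0 : ∀ x, z x 0 = z₁)
    (hz : ∀ x t, z x (t + 1) = P (z x t - ε t • G (x t) (z x t)))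
    (m : ℕ) {δ : ℝ} (hδ : 0 < δ) :
    1 - δ ≤ μ.real {ω | ∀ u ∈ K,
      ∑ t ∈ Finset.range m, ε t * inner ℝ (∫ y, G y (z (fun i => ξ i ω) t) ∂ν)
          (z (fun i => ξ i ω) t - u)
        ≤ R ^ 2 + (5 / 2 * B ^ 2 + 2 * B ^ 2 * R ^ 2) * ∑ t ∈ Finset.range m, ε t ^ 2
          + Real.log (1 / δ)} := by
  have hν : IsProbabilityMeasure ν := hlaw 0 ▸ Measure.isProbabilityMeasure_map (hm 0).aemeasurable
  obtain ⟨y₀⟩ : Nonempty E := ν.nonempty_of_neZero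
  have hB : 0 ≤ B := (norm_nonneg _).trans (hG y₀ z₁ hz₁)
  have hR0 : 0 ≤ R := (norm_nonneg _).trans (hR z₁ hz₁ z₁ hz₁)
  let Δ : E → H → H := fun y w => G y w - ∫ y', G y' w ∂ν
  have hΔ : ∀ y, ∀ w ∈ K, ‖Δ y w‖ ≤ 2 * B := fun y w hw => by
    have h1 : ‖∫ y', G y' w ∂ν‖ ≤ B := by
      simpa using norm_integral_le_of_norm_le_const (μ := ν) (ae_of_all _ fun y' => hG y' w hw)
    have h2 := norm_sub_le (G y w) (∫ y', G y' w ∂ν)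
    have h3 := hG y w hw
    simp only [Δ]
    linarith
  have hΔ0 : ∀ w, ∫ y, Δ y w ∂ν = 0 := fun w => by
    simp only [Δ]
    rw [integral_sub .of_finite .of_finite]
    simp
  -- The comparator `u` is chosen after the samples are seen. The noise is therefore paired with
  -- `z - v` instead of `z - u`, where the shadow sequence `v` is driven by the noise alone and
  -- has small regret against every `u`.
  let v : (ℕ → E) → ℕ → H := fun x t =>
    Nat.rec z₁ (fun t w => P (w - ε t • (-Δ (x t) (z x t)))) t
  have hv0 : ∀ x, v x 0 = z₁ := fun x => rfl
  have hv : ∀ x t, v x (t + 1) = P (v x t - ε t • (-Δ (x t) (z x t))) := fun x t => rfl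
  have hzK : ∀ x t, z x t ∈ K := fun x t => by
    cases t with
    | zero => rw [hz0]; exact hz₁
    | succ t => rw [hz]; exact hPK _
  have hvK : ∀ x t, v x t ∈ K := fun x t => by
    cases t with
    | zero => exact hz₁
    | succ t => exact hPK _
  have hzdep : ∀ t, DependsOn (fun x => z x t) (Set.Iio t) :=
    dependsOn_of_recursion (f := fun t x w => P (w - ε t • G (x t) w)) hz0 hz
      fun t x y hxy => by simp only [hxy t (Nat.lt_succ_self t)]
  have hvdep : ∀ t, DependsOn (fun x => v x t) (Set.Iio t) :=
    dependsOn_of_recursion (f := fun t x w => P (w - ε t • (-Δ (x t) (z x t)))) hv0 hv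
      fun t x y hxy => by
        have h1 : z x t = z y t := hzdep t fun i hi => hxy i (hi.trans (Nat.lt_succ_self t))
        simp only [hxy t (Nat.lt_succ_self t), h1]
  let D : ℕ → (ℕ → E) → E → ℝ := fun t x y =>
    ε t * inner ℝ (v x t - z x t) (Δ y (z x t))
  have hDdep : ∀ t, DependsOn (D t) (Set.Iio t) := fun t x y hxy => by
    have h1 : z x t = z y t := hzdep t hxy
    have h2 : v x t = v y t := hvdep t hxy
    simp only [D, h1, h2]
  have hDb : ∀ t x y, |D t x y| ≤ |ε t| * (R * (2 * B)) := fun t x y => by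
    rw [abs_mul]
    refine mul_le_mul_of_nonneg_left ((abs_real_inner_le_norm _ _).trans ?_) (abs_nonneg _)
    exact mul_le_mul (hR _ (hvK x t) _ (hzK x t)) (hΔ y _ (hzK x t)) (norm_nonneg _) hR0
  have hD0 : ∀ t x, ∫ y, D t x y ∂ν = 0 := fun t x => by
    simp only [D]
    rw [integral_const_mul, integral_inner .of_finite, hΔ0]
    simp
  refine (one_sub_le_measureReal_sum_le hm hind hlaw hDdep hDb hD0 m hδ).trans
    (measureReal_mono ?_)
  intro ω hω u hu
  set x : ℕ → E := fun i => ξ i ω with hx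
  have hnoise : ∑ t ∈ Finset.range m, ε t * inner ℝ (v x t - z x t) (Δ (x t) (z x t))
      ≤ ∑ t ∈ Finset.range m, (|ε t| * (R * (2 * B))) ^ 2 / 2 + Real.log (1 / δ) := hω
  have hregz := sum_inner_le_of_projected hP (g := fun t => G (x t) (z x t)) (hz x) hu m
  have hregv := sum_inner_le_of_projected hP (g := fun t => -Δ (x t) (z x t)) (hv x) hu m
  have hsq : ∀ w ∈ K, ‖w - u‖ ^ 2 ≤ R ^ 2 := fun w hw =>
    pow_le_pow_left₀ (norm_nonneg _) (hR w hw u hu) 2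
  have hGsq : ∑ t ∈ Finset.range m, ε t ^ 2 * ‖G (x t) (z x t)‖ ^ 2
      ≤ B ^ 2 * ∑ t ∈ Finset.range m, ε t ^ 2 := by
    rw [Finset.mul_sum]
    refine Finset.sum_le_sum fun t _ => ?_
    rw [mul_comm]
    exact mul_le_mul_of_nonneg_right
      (pow_le_pow_left₀ (norm_nonneg _) (hG _ _ (hzK x t)) 2) (sq_nonneg _)
  have hΔsq : ∑ t ∈ Finset.range m, ε t ^ 2 * ‖-Δ (x t) (z x t)‖ ^ 2
      ≤ (2 * B) ^ 2 * ∑ t ∈ Finset.range m, ε t ^ 2 := by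
    rw [Finset.mul_sum]
    refine Finset.sum_le_sum fun t _ => ?_
    rw [mul_comm, norm_neg]
    exact mul_le_mul_of_nonneg_right
      (pow_le_pow_left₀ (norm_nonneg _) (hΔ _ _ (hzK x t)) 2) (sq_nonneg _)
  have hbsq : ∑ t ∈ Finset.range m, (|ε t| * (R * (2 * B))) ^ 2 / 2
      = 2 * B ^ 2 * R ^ 2 * ∑ t ∈ Finset.range m, ε t ^ 2 := by
    rw [Finset.mul_sum]
    refine Finset.sum_congr rfl fun t _ => ?_
    rw [mul_pow, sq_abs]
    ring
  have hsplit : ∑ t ∈ Finset.range m, ε t * inner ℝ (∫ y, G y (z x t) ∂ν) (z x t - u)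
      = ∑ t ∈ Finset.range m, ε t * inner ℝ (G (x t) (z x t)) (z x t - u)
        + ∑ t ∈ Finset.range m, ε t * inner ℝ (v x t - z x t) (Δ (x t) (z x t))
        + ∑ t ∈ Finset.range m, ε t * inner ℝ (-Δ (x t) (z x t)) (v x t - u) := by
    rw [← Finset.sum_add_distrib, ← Finset.sum_add_distrib]
    refine Finset.sum_congr rfl fun t _ => ?_
    have h1 : (∫ y, G y (z x t) ∂ν) = G (x t) (z x t) - Δ (x t) (z x t) := by simp [Δ]
    rw [h1, real_inner_comm (Δ (x t) (z x t)) (v x t - z x t)]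
    simp only [inner_sub_left, inner_sub_right, inner_neg_left]
    ring
  have hz1 := hsq _ (hzK x 0)
  have hv1 := hsq _ (hvK x 0)
  have hzm := sq_nonneg ‖z x m - u‖
  have hvm := sq_nonneg ‖v x m - u‖
  rw [hsplit]
  linarith

end Projected

/-! ### Euclidean projections and the joint variable -/

section Proj

variable {H : Type*} [NormedAddCommGroup H] [InnerProductSpace ℝ H] [CompleteSpace H] {K : Set H}

theorem proj_spec (hc : IsClosed K) (hv : Convex ℝ K) (hne : K.Nonempty) (x : H) :
    proj K x ∈ K ∧ ∀ q ∈ K, ‖x - proj K x‖ ≤ ‖x - q‖ := by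
  refine Classical.epsilon_spec (p := fun p => p ∈ K ∧ ∀ q ∈ K, ‖x - p‖ ≤ ‖x - q‖) ?_
  obtain ⟨p, hp, hmin⟩ := exists_norm_eq_iInf_of_complete_convex hne hc.isComplete hv x
  refine ⟨p, hp, fun q hq => ?_⟩
  rw [hmin]
  exact ciInf_le ⟨0, by rintro _ ⟨w, rfl⟩; exact norm_nonneg _⟩ (⟨q, hq⟩ : K)

/-- Projecting onto a convex set does not increase the distance to any of its points. -/
theorem norm_proj_sub_le (hc : IsClosed K) (hv : Convex ℝ K) (hne : K.Nonempty) (x : H) {u : H}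
    (hu : u ∈ K) : ‖proj K x - u‖ ≤ ‖x - u‖ := by
  obtain ⟨hp, hmin⟩ := proj_spec hc hv hne x
  have : Nonempty K := hne.to_subtype
  have h1 : ‖x - proj K x‖ = ⨅ w : K, ‖x - w‖ :=
    le_antisymm (le_ciInf fun w => hmin w w.2)
      (ciInf_le ⟨0, by rintro _ ⟨w, rfl⟩; exact norm_nonneg _⟩ (⟨proj K x, hp⟩ : K))
  have h2 := (norm_eq_iInf_iff_real_inner_le_zero hv hp).1 h1 u hu
  refine le_of_sq_le_sq ?_ (norm_nonneg _)
  have h3 : x - u = (x - proj K x) - (u - proj K x) := by abel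
  rw [h3, norm_sub_sq_real (x - proj K x), norm_sub_rev (proj K x) u]
  nlinarith [sq_nonneg ‖x - proj K x‖]

end Proj

/-- The space of triples `(α, β, τ)` with its Euclidean norm. -/
abbrev Joint (d n : ℕ) : Type :=
  WithLp 2 (Param d n × WithLp 2 (Param d n × EuclideanSpace ℝ (Fin n)))

section Joint

variable {d n : ℕ}

/-- The triple `(α, β, τ)` as a point of the Euclidean space `Joint d n`. -/
def toJoint (a b : Param d n) (c : EuclideanSpace ℝ (Fin n)) : Joint d n :=
  WithLp.toLp 2 (a, WithLp.toLp 2 (b, c))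

theorem inner_toJoint (a b a' b' : Param d n) (c c' : EuclideanSpace ℝ (Fin n)) :
    inner ℝ (toJoint a b c) (toJoint a' b' c')
      = inner ℝ a a' + (inner ℝ b b' + inner ℝ c c') := by
  simp only [toJoint, WithLp.prod_inner_apply]

theorem norm_toJoint_sq (a b : Param d n) (c : EuclideanSpace ℝ (Fin n)) :
    ‖toJoint a b c‖ ^ 2 = ‖a‖ ^ 2 + (‖b‖ ^ 2 + ‖c‖ ^ 2) := by
  rw [← real_inner_self_eq_norm_sq, inner_toJoint]
  simp only [real_inner_self_eq_norm_sq]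

theorem norm_toJoint_le (a b : Param d n) (c : EuclideanSpace ℝ (Fin n)) :
    ‖toJoint a b c‖ ≤ ‖a‖ + ‖b‖ + ‖c‖ := by
  refine le_of_sq_le_sq ?_ (by positivity)
  rw [norm_toJoint_sq]
  nlinarith [mul_nonneg (norm_nonneg a) (norm_nonneg b), mul_nonneg (norm_nonneg a) (norm_nonneg c),
    mul_nonneg (norm_nonneg b) (norm_nonneg c)]

/-- The product `X × Y × Z` inside `Joint d n`. -/
def jointSet (X Y : Set (Param d n)) (Z : Set (EuclideanSpace ℝ (Fin n))) : Set (Joint d n) :=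
  {x | x.fst ∈ X ∧ x.snd.fst ∈ Y ∧ x.snd.snd ∈ Z}

/-- The componentwise projection onto `X × Y × Z`. -/
noncomputable def jointProj (X Y : Set (Param d n)) (Z : Set (EuclideanSpace ℝ (Fin n))) (x : Joint d n) :
    Joint d n :=
  toJoint (proj X x.fst) (proj Y x.snd.fst) (proj Z x.snd.snd)

variable {X Y : Set (Param d n)} {Z : Set (EuclideanSpace ℝ (Fin n))}

theorem jointProj_mem (hXc : IsClosed X) (hXv : Convex ℝ X) (hX : X.Nonempty)
    (hYc : IsClosed Y) (hYv : Convex ℝ Y) (hY : Y.Nonempty)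
    (hZc : IsClosed Z) (hZv : Convex ℝ Z) (hZ : Z.Nonempty) (x : Joint d n) :
    jointProj X Y Z x ∈ jointSet X Y Z :=
  ⟨(proj_spec hXc hXv hX _).1, (proj_spec hYc hYv hY _).1, (proj_spec hZc hZv hZ _).1⟩

theorem norm_jointProj_sub_le (hXc : IsClosed X) (hXv : Convex ℝ X) (hX : X.Nonempty)
    (hYc : IsClosed Y) (hYv : Convex ℝ Y) (hY : Y.Nonempty)
    (hZc : IsClosed Z) (hZv : Convex ℝ Z) (hZ : Z.Nonempty) (x : Joint d n) {u : Joint d n}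
    (hu : u ∈ jointSet X Y Z) : ‖jointProj X Y Z x - u‖ ≤ ‖x - u‖ := by
  refine le_of_sq_le_sq ?_ (norm_nonneg _)
  have h1 := pow_le_pow_left₀ (norm_nonneg _) (norm_proj_sub_le hXc hXv hX x.fst hu.1) 2
  have h2 := pow_le_pow_left₀ (norm_nonneg _) (norm_proj_sub_le hYc hYv hY x.snd.fst hu.2.1) 2
  have h3 := pow_le_pow_left₀ (norm_nonneg _) (norm_proj_sub_le hZc hZv hZ x.snd.snd hu.2.2) 2
  calc ‖jointProj X Y Z x - u‖ ^ 2
      = ‖proj X x.fst - u.fst‖ ^ 2 + (‖proj Y x.snd.fst - u.snd.fst‖ ^ 2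
          + ‖proj Z x.snd.snd - u.snd.snd‖ ^ 2) := norm_toJoint_sq _ _ _
    _ ≤ ‖x.fst - u.fst‖ ^ 2 + (‖x.snd.fst - u.snd.fst‖ ^ 2 + ‖x.snd.snd - u.snd.snd‖ ^ 2) := by
        linarith
    _ = ‖x - u‖ ^ 2 := (norm_toJoint_sq _ _ _).symm

end Joint

/-! ### The saddle function of a single sample -/

section Sample

variable {d n : ℕ}

/-- The linear map `α ↦ αᵀ φ`. -/
def linMap (φ : EuclideanSpace ℝ (Fin d)) : Param d n →ₗ[ℝ] EuclideanSpace ℝ (Fin n) where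
  toFun α := WithLp.toLp 2 (Matrix.mulVec (toMat α).transpose φ)
  map_add' α β := by
    ext j
    simp [toMat, Matrix.mulVec, dotProduct, add_mul, Finset.sum_add_distrib]
  map_smul' c α := by
    ext j
    simp [toMat, Matrix.mulVec, dotProduct, Finset.mul_sum, mul_assoc]

theorem linMap_apply (φ : EuclideanSpace ℝ (Fin d)) (α : Param d n) (j : Fin n) :
    linMap φ α j = ∑ i, α (i, j) * φ i := rfl

/-- The rank-one matrix `φ eᵀ`; as a function of `e` it is the adjoint of `linMap φ`. -/
def outer (φ : EuclideanSpace ℝ (Fin d)) (e : EuclideanSpace ℝ (Fin n)) : Param d n :=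
  ofMat (Matrix.vecMulVec φ e)

theorem outer_apply (φ : EuclideanSpace ℝ (Fin d)) (e : EuclideanSpace ℝ (Fin n))
    (p : Fin d × Fin n) : outer φ e p = φ p.1 * e p.2 := rfl

theorem inner_outer (φ : EuclideanSpace ℝ (Fin d)) (e : EuclideanSpace ℝ (Fin n))
    (α : Param d n) : inner ℝ (outer φ e) α = inner ℝ e (linMap φ α) := by
  simp only [PiLp.inner_apply, outer_apply, linMap_apply, Fintype.sum_prod_type,
    RCLike.inner_apply, conj_trivial, Finset.sum_mul]
  rw [Finset.sum_comm]
  refine Finset.sum_congr rfl fun j _ => Finset.sum_congr rfl fun i _ => ?_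
  ring

theorem norm_outer (φ : EuclideanSpace ℝ (Fin d)) (e : EuclideanSpace ℝ (Fin n)) :
    ‖outer φ e‖ = ‖φ‖ * ‖e‖ := by
  refine (sq_eq_sq₀ (norm_nonneg _) (by positivity)).1 ?_
  rw [mul_pow, EuclideanSpace.real_norm_sq_eq, EuclideanSpace.real_norm_sq_eq,
    EuclideanSpace.real_norm_sq_eq, Finset.sum_mul_sum, Fintype.sum_prod_type]
  simp only [outer_apply, mul_pow]

theorem norm_linMap_le (φ : EuclideanSpace ℝ (Fin d)) (α : Param d n) :
    ‖linMap φ α‖ ≤ ‖φ‖ * ‖α‖ := by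
  have h1 : ‖linMap φ α‖ ^ 2 ≤ ‖φ‖ * ‖linMap φ α‖ * ‖α‖ := by
    rw [← real_inner_self_eq_norm_sq, ← inner_outer, ← norm_outer]
    exact real_inner_le_norm _ _
  rcases (norm_nonneg (linMap φ α)).eq_or_lt with h | h
  · rw [← h]; positivity
  · refine le_of_mul_le_mul_left ?_ h
    linarith

/-- The saddle function of one sample with features `φ`, `φ'` and score `g`; its expectation
is `linObjective`. -/
noncomputable def sampleLoss (γ lam : ℝ) (φ φ' : EuclideanSpace ℝ (Fin d)) (g : EuclideanSpace ℝ (Fin n))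
    (α β : Param d n) (τ : EuclideanSpace ℝ (Fin n)) : ℝ :=
  inner ℝ (linMap φ β) (linMap φ α) - inner ℝ (linMap φ β) g
    - γ * inner ℝ (linMap φ' β) (linMap φ α) - (1 / 2) * ‖linMap φ β‖ ^ 2
    + lam * (inner ℝ τ (linMap φ α) - (1 / 2) * ‖τ‖ ^ 2)

/-- The saddle operator `(∇_α, -∇_β, -∇_τ)` of `sampleLoss`. -/
noncomputable def sampleOp (γ lam : ℝ) (φ φ' : EuclideanSpace ℝ (Fin d)) (g : EuclideanSpace ℝ (Fin n))
    (z : Joint d n) : Joint d n :=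
  toJoint (outer φ (linMap φ z.snd.fst - γ • linMap φ' z.snd.fst + lam • z.snd.snd))
    (-(outer φ (linMap φ z.fst - g - linMap φ z.snd.fst) - γ • outer φ' (linMap φ z.fst)))
    (-(lam • (linMap φ z.fst - z.snd.snd)))

/-- The convex-concave gradient inequality for one sample: the two sides differ by
`‖(β - u_β)ᵀ φ‖² / 2 + λ ‖τ - u_τ‖² / 2`. -/
theorem sampleLoss_sub_le_inner {γ lam : ℝ} (hlam : 0 ≤ lam) (φ φ' : EuclideanSpace ℝ (Fin d))
    (g : EuclideanSpace ℝ (Fin n)) (z u : Joint d n) :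
    sampleLoss γ lam φ φ' g z.fst u.snd.fst u.snd.snd
        - sampleLoss γ lam φ φ' g u.fst z.snd.fst z.snd.snd
      ≤ inner ℝ (sampleOp γ lam φ φ' g z) (z - u) := by
  obtain ⟨α, β, τ, rfl⟩ : ∃ a b c, z = toJoint a b c := ⟨_, _, _, rfl⟩
  obtain ⟨a, b, c, rfl⟩ : ∃ a b c, u = toJoint a b c := ⟨_, _, _, rfl⟩
  have h1 : inner ℝ (sampleOp γ lam φ φ' g (toJoint α β τ)) (toJoint α β τ - toJoint a b c)
      = inner ℝ (linMap φ β - γ • linMap φ' β + lam • τ) (linMap φ α - linMap φ a)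
        - (inner ℝ (linMap φ α - g - linMap φ β) (linMap φ β - linMap φ b)
          - γ * inner ℝ (linMap φ α) (linMap φ' β - linMap φ' b))
        - lam * inner ℝ (linMap φ α - τ) (τ - c) := by
    change inner ℝ (toJoint _ _ _) (toJoint (α - a) (β - b) (τ - c)) = _
    rw [inner_toJoint]
    change inner ℝ (outer φ (linMap φ β - γ • linMap φ' β + lam • τ)) (α - a)
      + (inner ℝ (-(outer φ (linMap φ α - g - linMap φ β) - γ • outer φ' (linMap φ α))) (β - b)
        + inner ℝ (-(lam • (linMap φ α - τ))) (τ - c)) = _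
    rw [inner_neg_left, inner_neg_left, inner_sub_left (outer φ _), real_inner_smul_left,
      real_inner_smul_left, inner_outer, inner_outer, inner_outer, map_sub, map_sub, map_sub]
    ring
  have h2 : 0 ≤ ‖linMap φ β - linMap φ b‖ ^ 2 := sq_nonneg _
  have h3 : 0 ≤ lam * ‖τ - c‖ ^ 2 := mul_nonneg hlam (sq_nonneg _)
  rw [h1]
  change sampleLoss γ lam φ φ' g α b c - sampleLoss γ lam φ φ' g a β τ ≤ _
  simp only [sampleLoss]
  generalize linMap φ α = x, linMap φ a = y, linMap φ β = p, linMap φ b = q,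
    linMap φ' β = p', linMap φ' b = q' at *
  rw [norm_sub_sq_real] at h2 h3
  have e1 : inner ℝ x p = inner ℝ p x := real_inner_comm _ _
  have e2 : inner ℝ x q = inner ℝ q x := real_inner_comm _ _
  have e3 : inner ℝ x p' = inner ℝ p' x := real_inner_comm _ _
  have e4 : inner ℝ x q' = inner ℝ q' x := real_inner_comm _ _
  have e5 : inner ℝ x τ = inner ℝ τ x := real_inner_comm _ _
  have e6 : inner ℝ x c = inner ℝ c x := real_inner_comm _ _
  have e7 : inner ℝ g p = inner ℝ p g := real_inner_comm _ _
  have e8 : inner ℝ g q = inner ℝ q g := real_inner_comm _ _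
  simp only [inner_sub_left, inner_sub_right, inner_add_left, real_inner_smul_left,
    real_inner_self_eq_norm_sq, e1, e2, e3, e4, e5, e6, e7, e8]
  linarith

theorem norm_sampleOp_le {γ lam κ κg ρ : ℝ} (hγ : 0 ≤ γ) (hγ1 : γ ≤ 1) (hlam : 0 ≤ lam)
    {φ φ' : EuclideanSpace ℝ (Fin d)} {g : EuclideanSpace ℝ (Fin n)} (hφ : ‖φ‖ ≤ κ)
    (hφ' : ‖φ'‖ ≤ κ) (hg : ‖g‖ ≤ κg) {z : Joint d n} (h1 : ‖z.fst‖ ≤ ρ) (h2 : ‖z.snd.fst‖ ≤ ρ)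
    (h3 : ‖z.snd.snd‖ ≤ ρ) :
    ‖sampleOp γ lam φ φ' g z‖ ≤ κ * (κ * ρ + κ * ρ + lam * ρ)
      + (κ * (κ * ρ + κg + κ * ρ) + κ * (κ * ρ)) + lam * (κ * ρ + ρ) := by
  have hκ : 0 ≤ κ := (norm_nonneg _).trans hφ
  have hρ : 0 ≤ ρ := (norm_nonneg _).trans h1
  have hlin : ∀ {f : EuclideanSpace ℝ (Fin d)} {x : Param d n}, ‖f‖ ≤ κ → ‖x‖ ≤ ρ →
      ‖linMap f x‖ ≤ κ * ρ := fun hf hx =>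
    (norm_linMap_le _ _).trans (mul_le_mul hf hx (norm_nonneg _) hκ)
  have hout : ∀ {f : EuclideanSpace ℝ (Fin d)} {e : EuclideanSpace ℝ (Fin n)} {r : ℝ}, ‖f‖ ≤ κ →
      ‖e‖ ≤ r → ‖outer f e‖ ≤ κ * r := fun hf he => by
    rw [norm_outer]; exact mul_le_mul hf he (norm_nonneg _) hκ
  have hγs : ∀ {V : Type} [NormedAddCommGroup V] [NormedSpace ℝ V] {x : V} {r : ℝ}, ‖x‖ ≤ r →
      ‖γ • x‖ ≤ r := fun hx => by
    rw [norm_smul, Real.norm_of_nonneg hγ]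
    exact (mul_le_of_le_one_left (norm_nonneg _) hγ1).trans hx
  have hls : ∀ {x : EuclideanSpace ℝ (Fin n)} {r : ℝ}, ‖x‖ ≤ r → ‖lam • x‖ ≤ lam * r :=
    fun hx => by
      rw [norm_smul, Real.norm_of_nonneg hlam]; exact mul_le_mul_of_nonneg_left hx hlam
  refine (norm_toJoint_le _ _ _).trans (add_le_add (add_le_add ?_ ?_) ?_)
  · exact hout hφ (norm_add_le_of_le (norm_sub_le_of_le (hlin hφ h2) (hγs (hlin hφ' h2))) (hls h3))
  · rw [norm_neg]
    exact norm_sub_le_of_le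
      (hout hφ (norm_sub_le_of_le (norm_sub_le_of_le (hlin hφ h1) hg) (hlin hφ h2)))
      (hγs (hout hφ' (hlin hφ h1)))
  · rw [norm_neg]
    exact hls (norm_sub_le_of_le (hlin hφ h1) h3)

end Sample

/-! ### Weighted averages -/

section Average

theorem sum_smul_weightedAvg {E : Type*} [AddCommGroup E] [Module ℝ E] {ε : ℕ → ℝ} {m : ℕ}
    (hW : ∑ t ∈ Finset.range m, ε t ≠ 0) (x : ℕ → E) :
    (∑ t ∈ Finset.range m, ε t) • weightedAvg ε m x = ∑ t ∈ Finset.range m, ε t • x t := by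
  rw [weightedAvg, smul_inv_smul₀ hW]

theorem map_weightedAvg {E F : Type*} [AddCommGroup E] [Module ℝ E] [AddCommGroup F] [Module ℝ F]
    (A : E →ₗ[ℝ] F) (ε : ℕ → ℝ) (m : ℕ) (x : ℕ → E) :
    A (weightedAvg ε m x) = weightedAvg ε m fun t => A (x t) := by
  simp [weightedAvg]

variable {H : Type*} [NormedAddCommGroup H] [InnerProductSpace ℝ H] {ε : ℕ → ℝ} {m : ℕ}

theorem sum_mul_inner_eq (hW : ∑ t ∈ Finset.range m, ε t ≠ 0) (e : H) (x : ℕ → H) :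
    ∑ t ∈ Finset.range m, ε t * inner ℝ e (x t)
      = (∑ t ∈ Finset.range m, ε t) * inner ℝ e (weightedAvg ε m x) := by
  rw [← real_inner_smul_right, sum_smul_weightedAvg hW, inner_sum]
  simp only [real_inner_smul_right]

theorem mul_norm_weightedAvg_sq_le (hε : ∀ t < m, 0 ≤ ε t)
    (hW : ∑ t ∈ Finset.range m, ε t ≠ 0) (x : ℕ → H) :
    (∑ t ∈ Finset.range m, ε t) * ‖weightedAvg ε m x‖ ^ 2
      ≤ ∑ t ∈ Finset.range m, ε t * ‖x t‖ ^ 2 := by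
  set a := weightedAvg ε m x with ha
  have h1 : 0 ≤ ∑ t ∈ Finset.range m, ε t * ‖a - x t‖ ^ 2 :=
    Finset.sum_nonneg fun t ht => mul_nonneg (hε t (Finset.mem_range.1 ht)) (sq_nonneg _)
  have h2 : ∑ t ∈ Finset.range m, ε t * ‖a - x t‖ ^ 2
      = (∑ t ∈ Finset.range m, ε t) * ‖a‖ ^ 2
        - 2 * ∑ t ∈ Finset.range m, ε t * inner ℝ a (x t)
        + ∑ t ∈ Finset.range m, ε t * ‖x t‖ ^ 2 := by
    simp only [Finset.mul_sum, Finset.sum_mul, ← Finset.sum_add_distrib, ← Finset.sum_sub_distrib]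
    refine Finset.sum_congr rfl fun t _ => ?_
    rw [norm_sub_sq_real]
    ring
  rw [sum_mul_inner_eq hW, ← ha, real_inner_self_eq_norm_sq] at h2
  linarith

/-- Jensen's inequality for the convex-concave function `sampleLoss`. -/
theorem mul_sampleLoss_weightedAvg_sub_le {d n : ℕ} {γ lam : ℝ} (hlam : 0 ≤ lam)
    (hε : ∀ t < m, 0 ≤ ε t) (hW : ∑ t ∈ Finset.range m, ε t ≠ 0)
    (φ φ' : EuclideanSpace ℝ (Fin d)) (g : EuclideanSpace ℝ (Fin n))
    (α β : ℕ → Param d n) (τ : ℕ → EuclideanSpace ℝ (Fin n))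
    (a b : Param d n) (c : EuclideanSpace ℝ (Fin n)) :
    (∑ t ∈ Finset.range m, ε t) * (sampleLoss γ lam φ φ' g (weightedAvg ε m α) b c
        - sampleLoss γ lam φ φ' g a (weightedAvg ε m β) (weightedAvg ε m τ))
      ≤ ∑ t ∈ Finset.range m, ε t * (sampleLoss γ lam φ φ' g (α t) b c
        - sampleLoss γ lam φ φ' g a (β t) (τ t)) := by
  simp only [sampleLoss, map_weightedAvg]
  have j1 := mul_norm_weightedAvg_sq_le hε hW fun t => linMap φ (β t)
  have j2 := mul_le_mul_of_nonneg_left (mul_norm_weightedAvg_sq_le hε hW τ) hlam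
  generalize linMap φ a = y, linMap φ b = q, linMap φ' b = q' at *
  have i1 := sum_mul_inner_eq hW (q - γ • q' + lam • c) fun t => linMap φ (α t)
  have i2 := sum_mul_inner_eq hW (y - g) fun t => linMap φ (β t)
  have i3 := sum_mul_inner_eq hW y fun t => linMap φ' (β t)
  have i4 := sum_mul_inner_eq hW y τ
  have hsplit : ∑ t ∈ Finset.range m, ε t *
      (inner ℝ q (linMap φ (α t)) - inner ℝ q g - γ * inner ℝ q' (linMap φ (α t))
          - 1 / 2 * ‖q‖ ^ 2 + lam * (inner ℝ c (linMap φ (α t)) - 1 / 2 * ‖c‖ ^ 2)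
        - (inner ℝ (linMap φ (β t)) y - inner ℝ (linMap φ (β t)) g
          - γ * inner ℝ (linMap φ' (β t)) y - 1 / 2 * ‖linMap φ (β t)‖ ^ 2
          + lam * (inner ℝ (τ t) y - 1 / 2 * ‖τ t‖ ^ 2)))
      = ∑ t ∈ Finset.range m, ε t * inner ℝ (q - γ • q' + lam • c) (linMap φ (α t))
        - (∑ t ∈ Finset.range m, ε t)
          * (inner ℝ q g + 1 / 2 * ‖q‖ ^ 2 + lam * (1 / 2 * ‖c‖ ^ 2))
        - ∑ t ∈ Finset.range m, ε t * inner ℝ (y - g) (linMap φ (β t))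
        + γ * ∑ t ∈ Finset.range m, ε t * inner ℝ y (linMap φ' (β t))
        - lam * ∑ t ∈ Finset.range m, ε t * inner ℝ y (τ t)
        + 1 / 2 * ∑ t ∈ Finset.range m, ε t * ‖linMap φ (β t)‖ ^ 2
        + 1 / 2 * (lam * ∑ t ∈ Finset.range m, ε t * ‖τ t‖ ^ 2) := by
    simp only [Finset.mul_sum, Finset.sum_mul, ← Finset.sum_add_distrib, ← Finset.sum_sub_distrib]
    refine Finset.sum_congr rfl fun t _ => ?_
    simp only [inner_sub_left, inner_add_left, real_inner_smul_left, real_inner_comm y,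
      real_inner_comm g]
    ring
  rw [hsplit, i1, i2, i3, i4]
  generalize (weightedAvg ε m fun t => linMap φ (α t)) = x,
    (weightedAvg ε m fun t => linMap φ (β t)) = p,
    (weightedAvg ε m fun t => linMap φ' (β t)) = p', weightedAvg ε m τ = r at *
  rw [real_inner_comm y p, real_inner_comm y p', real_inner_comm y r, real_inner_comm g p]
  simp only [inner_sub_left, inner_add_left, real_inner_smul_left]
  linarith

end Average

/-! ### The objective as an expectation over one sample -/

section Law

variable {d n : ℕ} {S A : Type*} [Fintype S] [Fintype A] {M : MDP S A} {π : ParamPolicy n S A}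
  {θ : EuclideanSpace ℝ (Fin n)}

theorem sum_next_eq_one (M : MDP S A) (π : ParamPolicy n S A) (θ : EuclideanSpace ℝ (Fin n))
    (s : S) (a : A) : ∑ s', ∑ a', M.P s a s' * π.prob θ s' a' = 1 := by
  simp only [← Finset.mul_sum, π.prob_sum, mul_one, M.P_sum]

/-- The saddle function of the sample `(s, a, s', a')`. -/
noncomputable def lossAt (M : MDP S A) (π : ParamPolicy n S A) (θ : EuclideanSpace ℝ (Fin n))
    (lam : ℝ) (Φ : S → A → EuclideanSpace ℝ (Fin d)) (y : S × A × S × A) (α β : Param d n)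
    (τ : EuclideanSpace ℝ (Fin n)) : ℝ :=
  sampleLoss M.γ lam (Φ y.1 y.2.1) (Φ y.2.2.1 y.2.2.2) (score π θ y.1 y.2.1) α β τ

/-- The saddle operator of the sample `(s, a, s', a')`. -/
noncomputable def opAt (M : MDP S A) (π : ParamPolicy n S A) (θ : EuclideanSpace ℝ (Fin n))
    (lam : ℝ) (Φ : S → A → EuclideanSpace ℝ (Fin d)) (y : S × A × S × A) (z : Joint d n) :
    Joint d n :=
  sampleOp M.γ lam (Φ y.1 y.2.1) (Φ y.2.2.1 y.2.2.2) (score π θ y.1 y.2.1) z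

variable [MeasurableSpace S] [DiscreteMeasurableSpace S] [MeasurableSpace A]
  [DiscreteMeasurableSpace A] {ν : Measure (S × A × S × A)} [IsProbabilityMeasure ν]

theorem integral_law_eq_sum (hν : ∀ s a s' a', ν.real {(s, a, s', a')}
      = occupancy M π θ s a * M.P s a s' * π.prob θ s' a') (f : S × A × S × A → ℝ) :
    ∫ y, f y ∂ν = ∑ s, ∑ a, occupancy M π θ s a *
      ∑ s', ∑ a', M.P s a s' * π.prob θ s' a' * f (s, a, s', a') := by
  rw [integral_fintype .of_finite]
  simp only [Fintype.sum_prod_type, hν, smul_eq_mul, Finset.mul_sum, mul_assoc]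

theorem expect_eq_integral (hν : ∀ s a s' a', ν.real {(s, a, s', a')}
      = occupancy M π θ s a * M.P s a s' * π.prob θ s' a') (h : S → A → ℝ) :
    expect M π θ h = ∫ y, h y.1 y.2.1 ∂ν := by
  rw [integral_law_eq_sum hν]
  simp only [← Finset.sum_mul, sum_next_eq_one, one_mul, expect]

theorem expect_nextExpect_eq_integral (hν : ∀ s a s' a', ν.real {(s, a, s', a')}
      = occupancy M π θ s a * M.P s a s' * π.prob θ s' a')
    (f w : S → A → EuclideanSpace ℝ (Fin n)) :
    expect M π θ (fun s a => inner ℝ (nextExpect M π θ f s a) (w s a))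
      = ∫ y, inner ℝ (f y.2.2.1 y.2.2.2) (w y.1 y.2.1) ∂ν := by
  rw [integral_law_eq_sum hν]
  simp only [expect, nextExpect, sum_inner, real_inner_smul_left]

theorem linObjective_eq_integral (hν : ∀ s a s' a', ν.real {(s, a, s', a')}
      = occupancy M π θ s a * M.P s a s' * π.prob θ s' a') (lam : ℝ)
    (Φ : S → A → EuclideanSpace ℝ (Fin d)) (α β : Param d n) (τ : EuclideanSpace ℝ (Fin n)) :
    linObjective M π θ lam Φ α β τ = ∫ y, lossAt M π θ lam Φ y α β τ ∂ν := by
  have hlin : ∀ (x : Param d n) s a, linApprox Φ x s a = linMap (Φ s a) x := fun _ _ _ => rfl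
  rw [linObjective, objective, expect_nextExpect_eq_integral hν]
  simp only [expect_eq_integral hν, lossAt, sampleLoss, hlin]
  rw [integral_add .of_finite .of_finite, integral_sub .of_finite .of_finite,
    integral_sub .of_finite .of_finite, integral_sub .of_finite .of_finite, integral_const_mul,
    integral_const_mul, integral_const_mul, integral_sub .of_finite .of_finite]
  simp

end Law

/-! ### The optimality gap of the averaged iterates -/

section Gap

variable {d n : ℕ} {S A : Type*} [Fintype S] [Fintype A] {M : MDP S A} {π : ParamPolicy n S A}
  {θ : EuclideanSpace ℝ (Fin n)} {lam : ℝ} {Φ : S → A → EuclideanSpace ℝ (Fin d)}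

/-- The triple `v` as a point of the Euclidean space `Joint d n`. -/
def Vars.toJoint (v : Vars d n) : Joint d n :=
  LogDensityGradient.toJoint v.α v.β v.τ

/-- One step of the algorithm is a projected step along the sampled saddle operator. -/
theorem toJoint_pldgStep (X Y : Set (Param d n)) (Z : Set (EuclideanSpace ℝ (Fin n))) (ε : ℝ)
    (x : S × A × S × A) (v : Vars d n) :
    (pldgStep M π θ lam Φ X Y Z ε x v).toJoint
      = jointProj X Y Z (v.toJoint - ε • opAt M π θ lam Φ x v.toJoint) := by
  change toJoint _ _ _ = toJoint (proj X (v.α - ε • _)) (proj Y (v.β - ε • -_))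
    (proj Z (v.τ - ε • -_))
  have hα : ofMat (deltaMat M.γ Φ x * toMat v.β
        + lam • Matrix.vecMulVec (Φ x.1 x.2.1) v.τ)
      = outer (Φ x.1 x.2.1) (linMap (Φ x.1 x.2.1) v.β
        - M.γ • linMap (Φ x.2.2.1 x.2.2.2) v.β + lam • v.τ) := by
    ext ⟨i, j⟩
    simp only [ofMat, deltaMat, outer_apply, Matrix.add_apply, Matrix.mul_apply, Matrix.sub_apply,
      Matrix.smul_apply, Matrix.vecMulVec_apply, toMat, Matrix.of_apply, smul_eq_mul,
      PiLp.add_apply, PiLp.sub_apply, PiLp.smul_apply, linMap_apply, Finset.mul_sum, mul_add,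
      mul_sub, sub_mul, Finset.sum_sub_distrib]
    congr 1
    · congr 1 <;> exact Finset.sum_congr rfl fun k _ => by ring
    · ring
  have hβ : ofMat ((deltaMat M.γ Φ x).transpose * toMat v.α
        - Matrix.vecMulVec (Φ x.1 x.2.1) (score π θ x.1 x.2.1)
        - Matrix.vecMulVec (Φ x.1 x.2.1) (Φ x.1 x.2.1) * toMat v.β)
      = outer (Φ x.1 x.2.1) (linMap (Φ x.1 x.2.1) v.α - score π θ x.1 x.2.1
          - linMap (Φ x.1 x.2.1) v.β)
        - M.γ • outer (Φ x.2.2.1 x.2.2.2) (linMap (Φ x.1 x.2.1) v.α) := by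
    ext ⟨i, j⟩
    simp only [ofMat, deltaMat, outer_apply, Matrix.mul_apply, Matrix.sub_apply,
      Matrix.transpose_apply,
      Matrix.smul_apply, Matrix.vecMulVec_apply, toMat, Matrix.of_apply, smul_eq_mul,
      PiLp.sub_apply, PiLp.smul_apply, linMap_apply, Finset.mul_sum,
      mul_sub, sub_mul, Finset.sum_sub_distrib]
    have e1 : ∀ k, Φ x.1 x.2.1 k * Φ x.1 x.2.1 i * v.α (k, j)
        = Φ x.1 x.2.1 i * (v.α (k, j) * Φ x.1 x.2.1 k) := fun k => by ring
    have e2 : ∀ k, M.γ * (Φ x.1 x.2.1 k * Φ x.2.2.1 x.2.2.2 i) * v.α (k, j)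
        = M.γ * (Φ x.2.2.1 x.2.2.2 i * (v.α (k, j) * Φ x.1 x.2.1 k)) := fun k => by ring
    have e3 : ∀ k, Φ x.1 x.2.1 i * Φ x.1 x.2.1 k * v.β (k, j)
        = Φ x.1 x.2.1 i * (v.β (k, j) * Φ x.1 x.2.1 k) := fun k => by ring
    simp only [e1, e2, e3]
    ring
  simp only [smul_neg, sub_neg_eq_add]
  rw [pldgStep, hα, hβ]
  rfl

/-- Only nonemptiness is needed: the bound on the supremum and the infimum is elementwise, so that
boundedness of the objective plays no role. -/
theorem optGap_le {X Y : Set (Param d n)} {Z : Set (EuclideanSpace ℝ (Fin n))} (hX : X.Nonempty)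
    (hY : Y.Nonempty) (hZ : Z.Nonempty) {v : Vars d n} {c : ℝ}
    (h : ∀ a ∈ X, ∀ b ∈ Y, ∀ t ∈ Z,
      linObjective M π θ lam Φ v.α b t - linObjective M π θ lam Φ a v.β v.τ ≤ c) :
    optGap M π θ lam Φ X Y Z v ≤ c := by
  rw [optGap, sub_le_iff_le_add]
  refine csSup_le ((hY.prod hZ).image _) ?_
  rintro _ ⟨p, ⟨hp1, hp2⟩, rfl⟩
  rw [← sub_le_iff_le_add']
  refine le_csInf (hX.image _) ?_
  rintro _ ⟨a, ha, rfl⟩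
  have := h a ha p.1 hp1 p.2 hp2
  simp only
  linarith

variable [MeasurableSpace S] [DiscreteMeasurableSpace S] [MeasurableSpace A]
  [DiscreteMeasurableSpace A] {ν : Measure (S × A × S × A)} [IsProbabilityMeasure ν]

/-- The gap of the averages is bounded by the averaged regret of the expected saddle operator. -/
theorem mul_linObjective_weightedAvg_sub_le (hlam : 0 ≤ lam)
    (hν : ∀ s a s' a', ν.real {(s, a, s', a')}
      = occupancy M π θ s a * M.P s a s' * π.prob θ s' a') {ε : ℕ → ℝ} {m : ℕ}
    (hε : ∀ t < m, 0 ≤ ε t) (hW : ∑ t ∈ Finset.range m, ε t ≠ 0) (v : ℕ → Vars d n)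
    (a b : Param d n) (c : EuclideanSpace ℝ (Fin n)) :
    (∑ t ∈ Finset.range m, ε t) *
      (linObjective M π θ lam Φ (weightedAvg ε m fun t => (v t).α) b c
        - linObjective M π θ lam Φ a (weightedAvg ε m fun t => (v t).β)
          (weightedAvg ε m fun t => (v t).τ))
      ≤ ∑ t ∈ Finset.range m, ε t * inner ℝ (∫ y, opAt M π θ lam Φ y (v t).toJoint ∂ν)
          ((v t).toJoint - toJoint a b c) := by
  rw [linObjective_eq_integral hν, linObjective_eq_integral hν,
    ← integral_sub .of_finite .of_finite, ← integral_const_mul]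
  have h1 : ∀ t, inner ℝ (∫ y, opAt M π θ lam Φ y (v t).toJoint ∂ν)
        ((v t).toJoint - toJoint a b c)
      = ∫ y, inner ℝ (opAt M π θ lam Φ y (v t).toJoint) ((v t).toJoint - toJoint a b c) ∂ν :=
    fun t => by
      rw [real_inner_comm, ← integral_inner .of_finite]
      simp only [real_inner_comm]
  simp only [h1, ← integral_const_mul]
  rw [← integral_finsetSum _ fun _ _ => .of_finite]
  refine integral_mono .of_finite .of_finite fun y => ?_
  refine (mul_sampleLoss_weightedAvg_sub_le hlam hε hW _ _ _ _ _ _ a b c).trans ?_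
  exact Finset.sum_le_sum fun t ht => mul_le_mul_of_nonneg_left
    (sampleLoss_sub_le_inner hlam _ _ _ (v t).toJoint (toJoint a b c))
    (hε t (Finset.mem_range.1 ht))

end Gap

end LogDensityGradient

/-! ### The convergence rate -/

open LogDensityGradient in
theorem mainTheorem1 {d n : ℕ}
    (X Y : Set (LogDensityGradient.Param d n)) (Z : Set (EuclideanSpace ℝ (Fin n)))
    (hXc : IsClosed X) (hXb : Bornology.IsBounded X) (hXv : Convex ℝ X)
    (hYc : IsClosed Y) (hYb : Bornology.IsBounded Y) (hYv : Convex ℝ Y)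
    (hZc : IsClosed Z) (hZb : Bornology.IsBounded Z) (hZv : Convex ℝ Z)
    (lam : ℝ) (hlam : 0 ≤ lam) (KΦ Kg c₁ c₂ : ℝ) (hc₁ : 0 < c₁) :
    ∃ C₀ : ℝ, 0 < C₀ ∧
      ∀ (S A : Type*) [Fintype S] [Fintype A]
        [MeasurableSpace S] [DiscreteMeasurableSpace S]
        [MeasurableSpace A] [DiscreteMeasurableSpace A]
        (M : LogDensityGradient.MDP S A) (π : LogDensityGradient.ParamPolicy n S A)
        (θ : EuclideanSpace ℝ (Fin n)) (Φ : S → A → EuclideanSpace ℝ (Fin d))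
        (_ : ∀ s a, ‖Φ s a‖ ^ 2 ≤ KΦ)
        (_ : ∀ s a, ‖LogDensityGradient.score π θ s a‖ ^ 2 ≤ Kg)
        (v₁ : LogDensityGradient.Vars d n) (_ : v₁.α ∈ X) (_ : v₁.β ∈ Y) (_ : v₁.τ ∈ Z)
        (Ω : Type*) [MeasurableSpace Ω] (μ : MeasureTheory.Measure Ω)
        [MeasureTheory.IsProbabilityMeasure μ] (ξ : ℕ → Ω → S × A × S × A)
        (_ : LogDensityGradient.IsSampleStream M π θ μ ξ)
        (m : ℕ) (_ : 1 ≤ m) (ε : ℕ → ℝ)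
        (_ : ∀ t < m, c₁ / √(m : ℝ) ≤ ε t ∧ ε t ≤ c₂ / √(m : ℝ))
        (δ : ℝ) (_ : 0 < δ) (_ : δ < 1),
        1 - δ ≤ μ.real {ω | LogDensityGradient.optGap M π θ lam Φ X Y Z
            (LogDensityGradient.pldgOutput M π θ lam Φ X Y Z ε v₁ (fun t => ξ t ω) m) ≤
          C₀ * √(5 / (m : ℝ)) * (8 + 2 * Real.log (2 / δ))} := by
  obtain ⟨ρX, hρX⟩ := hXb.exists_norm_le
  obtain ⟨ρY, hρY⟩ := hYb.exists_norm_le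
  obtain ⟨ρZ, hρZ⟩ := hZb.exists_norm_le
  obtain ⟨ρ, hX', hY', hZ'⟩ : ∃ ρ : ℝ, (∀ x ∈ X, ‖x‖ ≤ ρ) ∧ (∀ x ∈ Y, ‖x‖ ≤ ρ) ∧
      ∀ x ∈ Z, ‖x‖ ≤ ρ :=
    ⟨max ρX (max ρY ρZ), fun x hx => (hρX x hx).trans (le_max_left _ _),
      fun x hx => (hρY x hx).trans ((le_max_left _ _).trans (le_max_right _ _)),
      fun x hx => (hρZ x hx).trans ((le_max_right _ _).trans (le_max_right _ _))⟩
  obtain ⟨κ, hκ⟩ : ∃ κ : ℝ, κ = √KΦ := ⟨_, rfl⟩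
  -- `B` bounds the sampled saddle operator on `X × Y × Z`; see `norm_sampleOp_le`.
  obtain ⟨B, hB⟩ : ∃ B : ℝ, B = κ * (κ * ρ + κ * ρ + lam * ρ)
      + (κ * (κ * ρ + √Kg + κ * ρ) + κ * (κ * ρ)) + lam * (κ * ρ + ρ) := ⟨_, rfl⟩
  -- Three components of norm at most `ρ` give a diameter of at most `6 ρ`.
  obtain ⟨R, hR⟩ : ∃ R : ℝ, R = 3 * ρ + 3 * ρ := ⟨_, rfl⟩
  obtain ⟨Q, hQ⟩ : ∃ Q : ℝ, Q = R ^ 2 + (5 / 2 * B ^ 2 + 2 * B ^ 2 * R ^ 2) * c₂ ^ 2 :=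
    ⟨_, rfl⟩
  have hQ0 : 0 ≤ Q := by rw [hQ]; positivity
  refine ⟨(Q + 1) / c₁, by positivity, ?_⟩
  intro S A _ _ _ _ _ _ M π θ Φ hΦ hg v₁ hα₁ hβ₁ hτ₁ Ω _ μ _ ξ hξ m hm ε hε δ hδ hδ1
  have hXne : X.Nonempty := ⟨_, hα₁⟩
  have hYne : Y.Nonempty := ⟨_, hβ₁⟩
  have hZne : Z.Nonempty := ⟨_, hτ₁⟩
  set ν : Measure (S × A × S × A) := μ.map (ξ 0) with hνdef
  have hνprob : IsProbabilityMeasure ν :=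
    Measure.isProbabilityMeasure_map (hξ.measurable 0).aemeasurable
  have hmap : ∀ t y, (μ.map (ξ t)).real {y} = μ.real (ξ t ⁻¹' {y}) := fun t y =>
    map_measureReal_apply (hξ.measurable t) (MeasurableSet.of_discrete)
  have hlaw : ∀ t, μ.map (ξ t) = ν := fun t => by
    have := Measure.isProbabilityMeasure_map (μ := μ) (hξ.measurable t).aemeasurable
    refine Measure.ext_of_singleton fun y => ?_
    rw [← measureReal_eq_measureReal_iff, hmap, hνdef, hmap]
    obtain ⟨s, a, s', a'⟩ := y
    rw [hξ.law, hξ.law]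
  have hν : ∀ s a s' a', ν.real {(s, a, s', a')}
      = occupancy M π θ s a * M.P s a s' * π.prob θ s' a' := fun s a s' a' => by
    rw [hνdef, hmap, hξ.law]
  have hΦ' : ∀ s a, ‖Φ s a‖ ≤ κ := fun s a => hκ ▸ Real.le_sqrt_of_sq_le (hΦ s a)
  have hg' : ∀ s a, ‖score π θ s a‖ ≤ √Kg := fun s a => Real.le_sqrt_of_sq_le (hg s a)
  have hnorm : ∀ x ∈ jointSet X Y Z, ‖x‖ ≤ 3 * ρ := fun x hx => by
    have h1 := norm_toJoint_le x.fst x.snd.fst x.snd.snd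
    have h2 := hX' _ hx.1
    have h3 := hY' _ hx.2.1
    have h4 := hZ' _ hx.2.2
    change ‖x‖ ≤ _ at h1
    linarith
  have hprob := one_sub_le_measureReal_forall_sum_inner_le hξ.measurable hξ.indep hlaw
    (jointProj_mem hXc hXv hXne hYc hYv hYne hZc hZv hZne)
    (fun x u hu => norm_jointProj_sub_le hXc hXv hXne hYc hYv hYne hZc hZv hZne x hu)
    (R := R) (fun x hx u hu =>
      (norm_sub_le_of_le (hnorm x hx) (hnorm u hu)).trans_eq hR.symm)
    (G := opAt M π θ lam Φ) (B := B)
    (fun y z hz => (norm_sampleOp_le M.γ_nonneg M.γ_le_one hlam (hΦ' _ _) (hΦ' _ _) (hg' _ _)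
      (hX' _ hz.1) (hY' _ hz.2.1) (hZ' _ hz.2.2)).trans_eq hB.symm)
    (ε := ε) (z₁ := v₁.toJoint) ⟨hα₁, hβ₁, hτ₁⟩
    (z := fun x t => (pldgIter M π θ lam Φ X Y Z ε v₁ x t).toJoint) (fun _ => rfl)
    (fun x t => toJoint_pldgStep X Y Z (ε t) (x t) _) m hδ
  refine hprob.trans (measureReal_mono fun ω hω => ?_)
  have hm0 : (0 : ℝ) < m := by exact_mod_cast hm
  have hsm : 0 < √(m : ℝ) := Real.sqrt_pos.2 hm0
  have hε0 : ∀ t < m, 0 ≤ ε t := fun t ht => (by positivity : 0 ≤ c₁ / √(m : ℝ)).trans (hε t ht).1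
  have hW : c₁ * √(m : ℝ) ≤ ∑ t ∈ Finset.range m, ε t := by
    have h1 := Finset.card_nsmul_le_sum (Finset.range m) ε (c₁ / √(m : ℝ))
      fun t ht => (hε t (Finset.mem_range.1 ht)).1
    refine (le_of_eq ?_).trans h1
    rw [Finset.card_range, nsmul_eq_mul]
    field_simp
    rw [Real.sq_sqrt hm0.le]
  have hsq : ∑ t ∈ Finset.range m, ε t ^ 2 ≤ c₂ ^ 2 := by
    have h1 := Finset.sum_le_card_nsmul (Finset.range m) (fun t => ε t ^ 2)
      ((c₂ / √(m : ℝ)) ^ 2) fun t ht => by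
        have h2 := Finset.mem_range.1 ht
        exact pow_le_pow_left₀ (hε0 t h2) (hε t h2).2 2
    refine h1.trans (le_of_eq ?_)
    rw [Finset.card_range, nsmul_eq_mul, div_pow, Real.sq_sqrt hm0.le]
    field_simp
  have hWpos : 0 < ∑ t ∈ Finset.range m, ε t := (by positivity : 0 < c₁ * √(m : ℝ)).trans_le hW
  have hlog : 0 ≤ Real.log (1 / δ) := Real.log_nonneg (one_le_one_div hδ hδ1.le)
  have hlog2 : Real.log (1 / δ) ≤ Real.log (2 / δ) :=
    Real.log_le_log (by positivity) (by gcongr; norm_num)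
  have hbound : (Q + Real.log (1 / δ)) / (c₁ * √(m : ℝ))
      ≤ (Q + 1) / c₁ * √(5 / (m : ℝ)) * (8 + 2 * Real.log (2 / δ)) := by
    have h5 : 1 / √(m : ℝ) ≤ √(5 / (m : ℝ)) := by
      rw [Real.sqrt_div (by norm_num)]
      gcongr
      exact Real.one_le_sqrt.2 (by norm_num)
    have h6 : Q + Real.log (1 / δ) ≤ (Q + 1) * (8 + 2 * Real.log (2 / δ)) := by
      nlinarith [mul_nonneg hQ0 (hlog.trans hlog2)]
    calc (Q + Real.log (1 / δ)) / (c₁ * √(m : ℝ))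
        ≤ (Q + 1) * (8 + 2 * Real.log (2 / δ)) / (c₁ * √(m : ℝ)) := by gcongr
      _ = (Q + 1) / c₁ * (1 / √(m : ℝ)) * (8 + 2 * Real.log (2 / δ)) := by field_simp
      _ ≤ _ := by
        have : 0 ≤ 8 + 2 * Real.log (2 / δ) := by linarith
        gcongr
  refine optGap_le hXne hYne hZne fun a ha b hb c hc => le_trans ?_ hbound
  have h7 := (mul_linObjective_weightedAvg_sub_le (M := M) (π := π) (θ := θ) (Φ := Φ) hlam hν hε0
    hWpos.ne' (pldgIter M π θ lam Φ X Y Z ε v₁ fun t => ξ t ω) a b c).trans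
    (hω (toJoint a b c) ⟨ha, hb, hc⟩)
  have h8 : (5 / 2 * B ^ 2 + 2 * B ^ 2 * R ^ 2) * ∑ t ∈ Finset.range m, ε t ^ 2
      ≤ (5 / 2 * B ^ 2 + 2 * B ^ 2 * R ^ 2) * c₂ ^ 2 :=
    mul_le_mul_of_nonneg_left hsq (by positivity)
  rw [mul_comm, ← le_div_iff₀ hWpos] at h7
  refine h7.trans ((div_le_div_of_nonneg_right (c := ∑ t ∈ Finset.range m, ε t)
    (b := Q + Real.log (1 / δ)) (by linarith) hWpos.le).trans ?_)
  exact div_le_div_of_nonneg_left (by positivity) (by positivity) hW
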